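/- **Conventions.** All metric spaces carry their Borel $\sigma$-algebra. Let $p\in[1,\infty]$. For a metric space $(X,d_X)$, if $p<\infty$ let $\mathcal P_p(X)$ be the set of Borel probability measures $\alpha$ on $X$ with $\int_X d_X(x,x_0)^p\,d\alpha(x)<\infty$ for all $x_0\in X$, and let $\mathcal P_\infty(X)$ be the set of Borel probability measures on $X$ with bounded support. For $\alpha,\beta\in\mathcal P_p(X)$ let $\mathcal C(\alpha,\beta)$ be the set of Borel measures on $X\times X$ with marginals $\alpha$ and $\beta$, and put $$d_{\mathcal W,p}^X(\alpha,\beta)=\inf_{\mu\in\mathcal C(\alpha,\beta)}\Big(\int_{X\times X} d_X(x_1,x_2)^p\,d\mu(x_1,x_2)\Big)^{1/p}\quad(p<\infty),\qquad d_{\mathcal W,\infty}^X(\alpha,\beta)=\inf_{\mu\in\mathcal C(\alpha,\beta)}\ \sup_{(x_1,x_2)\in\operatorname{supp}\mu} d_X(x_1,x_2).$$ Write $\mathcal W_p(X)=(\mathcal P_p(X),d^X_{\mathcal W,p})$; if $X$ is compact, $\mathcal P_p(X)$ is the set of all Borel probability measures on $X$. For subsets $A,B$ of a space with distance $d$, the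 Hausdorff distance is $d_{\mathcal H}(A,B)=\max\big(\sup_{a\in A}\inf_{b\in B}d(a,b),\ \sup_{b\in B}\inf_{a\in A}d(a,b)\big)$. The Gromov–Hausdorff distance $d_{\mathcal{GH}}(A,B)$ is the infimum of $d_{\mathcal H}^Z(\varphi(A),\psi(B))$ over all metric spaces $Z$ and all distance-preserving maps $\varphi:A\to Z$, $\psi:B\to Z$. A map is called an isometric embedding if it preserves distances. **Theorem.** Let $X$ and $Y$ be compact metric spaces and let $p\in[1,\infty]$. 1. Let $Z$ be a (not necessarily compact) metric space and let $\varphi_X:X\to Z$ and $\varphi_Y:Y\to Z$ be isometric embeddings. Then the pushforward maps $(\varphi_X)_\#:\mathcal W_p(X)\to\mathcal W_p(Z)$ and $(\varphi_Y)_\#:\mathcal W_p(Y)\to\mathcal W_p(Z)$ are isometric embeddings, and $$d_{\mathcal H}^{\mathcal W_p(Z)}\big((\varphi_X)_\#(\mathcal W_p(X)),(\varphi_Y)_\#(\mathcal W_p(Y))\big)=d_{\mathcal H}^Z\big(\varphi_X(X),\varphi_Y(Y)\big).$$ 2. $d_{\mathcal{GH}}\big(\mathcal W_p(X),\mathcal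 W_p(Y)\big)\le d_{\mathcal{GH}}(X,Y)$. -/

import Mathlib

open MeasureTheory
open scoped ENNReal

universe u v w

noncomputable section

namespace WassersteinHyperspace

/-- The class `𝒫_p(X)`: Borel probability measures with finite `p`-th moments about every point
(`p < ∞`), respectively with bounded support (`p = ∞`). -/
def HasFiniteMoment {X : Type u} [MetricSpace X] [MeasurableSpace X]
    (p : ℝ≥0∞) (α : ProbabilityMeasure X) : Prop :=
  if p = ∞ then Bornology.IsBounded (α : Measure X).support
  else ∀ x₀ : X, ∫⁻ x, edist x x₀ ^ p.toReal ∂(α : Measure X) < ∞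

/-- The underlying set `𝒫_p(X)` of the `ℓ^p`-Wasserstein hyperspace `𝒲_p(X)`. -/
def WSpace (p : ℝ≥0∞) (X : Type u) [MetricSpace X] [MeasurableSpace X] : Type u :=
  {α : ProbabilityMeasure X // HasFiniteMoment p α}

/-- Borel measures on `X × X`. The Borel σ-algebra of the product topology is used explicitly: it
is the product σ-algebra when `X` is separable, and in general it makes the distance function
measurable. -/
abbrev BorelMeasureProd (X : Type u) [TopologicalSpace X] : Type u :=
  @Measure (X × X) (borel (X × X))

/-- `μ` is a coupling of `α` and `β`: its marginals are `α` and `β`. -/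
def IsCoupling {X : Type u} [TopologicalSpace X] [MeasurableSpace X]
    (α β : Measure X) (μ : BorelMeasureProd X) : Prop :=
  @Measure.map (X × X) X (borel (X × X)) _ Prod.fst μ = α ∧
  @Measure.map (X × X) X (borel (X × X)) _ Prod.snd μ = β

/-- The `ℓ^p`-cost of `μ`: `(∫ d(x₁,x₂)^p dμ)^{1/p}` for `p < ∞`, and the supremum of the distance
over the support of `μ` for `p = ∞`. -/
def cost {X : Type u} [MetricSpace X] (p : ℝ≥0∞) (μ : BorelMeasureProd X) : ℝ≥0∞ :=
  if p = ∞ then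
    ⨆ z ∈ @Measure.support (X × X) _ (borel (X × X)) μ, edist z.1 z.2
  else
    (@lintegral (X × X) (borel (X × X)) μ fun z => edist z.1 z.2 ^ p.toReal) ^ (1 / p.toReal)

/-- The `ℓ^p`-Wasserstein distance, with values in `[0,∞]`, as the distance of `𝒲_p(X)`. -/
instance {X : Type u} [MetricSpace X] [MeasurableSpace X] (p : ℝ≥0∞) : EDist (WSpace p X) where
  edist α β := ⨅ μ : BorelMeasureProd X,
    ⨅ _ : IsCoupling (α.1 : Measure X) (β.1 : Measure X) μ, cost p μ

/-- Distance preserving maps; between metric spaces this is Mathlib's `Isometry`. -/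
def IsIsometricEmbedding {A : Type u} {B : Type v} [EDist A] [EDist B] (f : A → B) : Prop :=
  ∀ a b : A, edist (f a) (f b) = edist a b

/-- The Hausdorff distance of two subsets of a space with a `[0,∞]`-valued distance;
see `hausdorff_eq` for the comparison with Mathlib's notion. -/
def hausdorff {A : Type u} [EDist A] (S T : Set A) : ℝ≥0∞ :=
  (⨆ x ∈ S, ⨅ y ∈ T, edist x y) ⊔ (⨆ y ∈ T, ⨅ x ∈ S, edist y x)

theorem hausdorff_eq {A : Type u} [PseudoEMetricSpace A] (S T : Set A) :
    hausdorff S T = Metric.hausdorffEDist S T := by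
  simp only [hausdorff, Metric.hausdorffEDist_def, Metric.infEDist]

/-- The Gromov–Hausdorff distance: the infimum of the Hausdorff distances `d_H^Z(φ(A), ψ(B))` over
all metric spaces `Z` and isometric embeddings `φ : A → Z`, `ψ : B → Z`. Since `Z` may be replaced
by `φ(A) ∪ ψ(B)`, the universe of `Z` is no restriction. No compactness is required (`𝒲_∞(X)` need
not be compact even if `X` is). -/
def ghEDist (A : Type u) (B : Type v) [EDist A] [EDist B] : ℝ≥0∞ :=
  ⨅ (Z : Type (max u v)) (_ : MetricSpace Z) (φ : A → Z) (ψ : B → Z)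
    (_ : IsIsometricEmbedding φ) (_ : IsIsometricEmbedding ψ),
    Metric.hausdorffEDist (Set.range φ) (Set.range ψ)

theorem hasFiniteMoment_map {X : Type u} {Z : Type v}
    [MetricSpace X] [CompactSpace X] [MeasurableSpace X] [BorelSpace X]
    [MetricSpace Z] [MeasurableSpace Z] [BorelSpace Z] (p : ℝ≥0∞)
    {φ : X → Z} (hφ : Isometry φ) (α : ProbabilityMeasure X) :
    HasFiniteMoment p (α.map hφ.continuous.aemeasurable) := by
  have hK : IsCompact (Set.range φ) := isCompact_range hφ.continuous
  unfold HasFiniteMoment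
  split_ifs with hp
  · refine hK.isBounded.subset (Measure.support_subset_of_isClosed hK.isClosed ?_)
    rw [ProbabilityMeasure.toMeasure_map, mem_ae_map_iff hφ.continuous.aemeasurable
      hK.isClosed.measurableSet]
    simp
  · intro z₀
    rw [ProbabilityMeasure.toMeasure_map, lintegral_map (by fun_prop) hφ.continuous.measurable]
    obtain ⟨C, hC⟩ := (hK.union isCompact_singleton : IsCompact (Set.range φ ∪ {z₀})).isBounded
      |> Metric.isBounded_iff.1
    calc ∫⁻ x, edist (φ x) z₀ ^ p.toReal ∂(α : Measure X)
        ≤ ∫⁻ _, ENNReal.ofReal C ^ p.toReal ∂(α : Measure X) := by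
          refine lintegral_mono fun x => ?_
          refine ENNReal.rpow_le_rpow ?_ ENNReal.toReal_nonneg
          rw [edist_dist]
          exact ENNReal.ofReal_le_ofReal (hC (Or.inl ⟨x, rfl⟩) (Or.inr rfl))
      _ < ∞ := by
          simp only [lintegral_const, measure_univ, mul_one]
          exact ENNReal.rpow_lt_top_of_nonneg ENNReal.toReal_nonneg ENNReal.ofReal_ne_top

/-- The pushforward `φ_# : 𝒲_p(X) → 𝒲_p(Z)` under an isometric embedding `φ : X → Z` of a compact
metric space `X`. -/
def pushforward {X : Type u} {Z : Type v}
    [MetricSpace X] [CompactSpace X] [MeasurableSpace X] [BorelSpace X]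
    [MetricSpace Z] [MeasurableSpace Z] [BorelSpace Z] (p : ℝ≥0∞)
    {φ : X → Z} (hφ : Isometry φ) (α : WSpace p X) : WSpace p Z :=
  ⟨α.1.map hφ.continuous.aemeasurable, hasFiniteMoment_map p hφ α.1⟩

end WassersteinHyperspace

end

namespace WassersteinHyperspace

open Metric Set ProbabilityTheory Topology

/-! Since `X` is compact, `φ × φ` is a closed embedding. Pushing a coupling forward along it
preserves the cost, and every coupling of `φ_# α` and `φ_# β` is concentrated on `φ(X) × φ(X)`,
hence is such a pushforward. So `φ_#` is isometric (`isIsometricEmbedding_pushforward`).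

For the Hausdorff distance, if each `φ(x)` is within `c` of `ψ(Y)`, a measurable choice `f : X → Y`
of nearby points transports `α` to `f_# α` at cost at most `c` (`exists_edist_pushforward_le`).
Conversely, Dirac masses recover the distance from `φ(x)` to `ψ(Y)`
(`iInf_edist_le_edist_pushforward_dirac`).

All this happens inside the compact space `K = φ(X) ∪ ψ(Y)`. There the cost is an `L^p` norm on the
product σ-algebra, and `𝒲_p(K)` is a genuine metric space, so it competes in the Gromov–Hausdorff
infimum; this gives the second claim. -/

theorem iInf_cost_eq_of_borel_eq {X : Type u} [MetricSpace X] [MeasurableSpace X] (p : ℝ≥0∞)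
    (α β : Measure X) (m : MeasurableSpace (X × X)) (h : borel (X × X) = m) :
    (⨅ μ : BorelMeasureProd X, ⨅ _ : IsCoupling α β μ, cost p μ) =
      ⨅ μ : Measure (X × X), ⨅ _ : μ.map Prod.fst = α ∧ μ.map Prod.snd = β,
        if p = ∞ then ⨆ z ∈ μ.support, edist z.1 z.2
        else (∫⁻ z, edist z.1 z.2 ^ p.toReal ∂μ) ^ (1 / p.toReal) := by
  -- Keeping the σ-algebra a variable lets `borel (X × X)` be traded for the product instance
  -- without dependent rewriting.
  subst h
  rfl

/-- For `p = ∞`, a value above the essential supremum would be exceeded on an open null set, which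
misses the support; conversely the support is conull. -/
theorem cost_eq_eLpNorm {X : Type u} [MetricSpace X] [CompactSpace X] [MeasurableSpace X]
    [OpensMeasurableSpace X] {p : ℝ≥0∞}
    (hp : p ≠ 0) (μ : Measure (X × X)) :
    (if p = ∞ then ⨆ z ∈ μ.support, edist z.1 z.2
      else (∫⁻ z, edist z.1 z.2 ^ p.toReal ∂μ) ^ (1 / p.toReal)) =
    eLpNorm (fun z : X × X => edist z.1 z.2) p μ := by
  split_ifs with h
  · subst h
    rw [eLpNorm_exponent_top]
    refine le_antisymm (iSup₂_le fun z hz => ?_) ?_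
    · by_contra! hlt
      have hopen : IsOpen {y : X × X | eLpNormEssSup (fun z : X × X => edist z.1 z.2) μ <
          edist y.1 y.2} := isOpen_lt continuous_const (by fun_prop)
      refine ((Measure.mem_support_iff_forall z).1 hz _ (hopen.mem_nhds hlt)).ne' ?_
      have := enorm_ae_le_eLpNormEssSup (fun z : X × X => edist z.1 z.2) μ
      simpa [ae_iff] using this
    · refine essSup_le_of_ae_le _ ?_
      filter_upwards [Measure.support_mem_ae (μ := μ)] with z hz
      exact le_iSup₂ (f := fun (z : X × X) (_ : z ∈ μ.support) => edist z.1 z.2) z hz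
  · rw [eLpNorm_eq_lintegral_rpow_enorm_toReal hp h]
    rfl

theorem isProbabilityMeasure_of_map_fst {X : Type*} [MeasurableSpace X] {α : ProbabilityMeasure X}
    {μ : Measure (X × X)}
    (h : μ.map Prod.fst = (α : Measure X)) : IsProbabilityMeasure μ := by
  rw [← Measure.isProbabilityMeasure_map_iff (f := Prod.fst) measurable_fst.aemeasurable, h]
  infer_instance

theorem eLpNorm_le_of_forall_ae_le {T : Type*} [MeasurableSpace T] {π : Measure T}
    [IsProbabilityMeasure π] {p c : ℝ≥0∞} {f : T → ℝ≥0∞} (hf : ∀ᵐ t ∂π, f t ≤ c) :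
    eLpNorm f p π ≤ c :=
  (eLpNorm_le_of_ae_enorm_bound hf).trans_eq (by simp)

theorem le_eLpNorm_of_forall_ae_le {T : Type*} [MeasurableSpace T] {π : Measure T}
    [IsProbabilityMeasure π] {p c : ℝ≥0∞} (hp : p ≠ 0) {f : T → ℝ≥0∞}
    (hf : ∀ᵐ t ∂π, c ≤ f t) : c ≤ eLpNorm f p π :=
  calc c = eLpNorm (fun _ : T => c) p π := by
        rw [eLpNorm_const c hp (IsProbabilityMeasure.ne_zero π)]; simp
    _ ≤ eLpNorm f p π := eLpNorm_mono_enorm_ae hf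

/-! ### The Wasserstein metric over a compact space -/

section Compact

variable {X : Type u} [MetricSpace X] [CompactSpace X] [MeasurableSpace X] [BorelSpace X]

theorem edist_eq_iInf_eLpNorm {p : ℝ≥0∞} (hp : p ≠ 0) (α β : WSpace p X) :
    edist α β = ⨅ μ : Measure (X × X),
      ⨅ _ : μ.map Prod.fst = (α.1 : Measure X) ∧ μ.map Prod.snd = (β.1 : Measure X),
        eLpNorm (fun z : X × X => edist z.1 z.2) p μ := by
  simp_rw [← cost_eq_eLpNorm hp]
  exact iInf_cost_eq_of_borel_eq p _ _ _ BorelSpace.measurable_eq.symm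

theorem edist_le_eLpNorm {p : ℝ≥0∞} (hp : p ≠ 0) {α β : WSpace p X} {μ : Measure (X × X)}
    (h₁ : μ.map Prod.fst = (α.1 : Measure X)) (h₂ : μ.map Prod.snd = (β.1 : Measure X)) :
    edist α β ≤ eLpNorm (fun z : X × X => edist z.1 z.2) p μ :=
  edist_eq_iInf_eLpNorm hp α β ▸ iInf₂_le μ ⟨h₁, h₂⟩

theorem exists_eLpNorm_lt {p : ℝ≥0∞} (hp : p ≠ 0) {α β : WSpace p X} {c : ℝ≥0∞}
    (h : edist α β < c) : ∃ μ : Measure (X × X), IsProbabilityMeasure μ ∧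
      μ.map Prod.fst = (α.1 : Measure X) ∧ μ.map Prod.snd = (β.1 : Measure X) ∧
      eLpNorm (fun z : X × X => edist z.1 z.2) p μ < c := by
  simp only [edist_eq_iInf_eLpNorm hp, iInf_lt_iff] at h
  obtain ⟨μ, ⟨h₁, h₂⟩, hμ⟩ := h
  exact ⟨μ, isProbabilityMeasure_of_map_fst h₁, h₁, h₂, hμ⟩

theorem edist_map_le {T : Type*} [MeasurableSpace T] {p : ℝ≥0∞} (hp : p ≠ 0)
    {α β : WSpace p X} {π : Measure T} {f g : T → X} (hf : Measurable f) (hg : Measurable g)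
    (h₁ : π.map f = (α.1 : Measure X)) (h₂ : π.map g = (β.1 : Measure X)) :
    edist α β ≤ eLpNorm (fun t => edist (f t) (g t)) p π := by
  have hfg : Measurable fun t => (f t, g t) := hf.prodMk hg
  refine (edist_le_eLpNorm hp (μ := π.map fun t => (f t, g t)) ?_ ?_).trans_eq ?_
  · rwa [Measure.map_map measurable_fst hfg]
  · rwa [Measure.map_map measurable_snd hfg]
  · rw [eLpNorm_map_measure (by fun_prop) hfg.aemeasurable]
    rfl

/-- Disintegrate `ν` over its first coordinate and attach the conditional law to the second
coordinate of `μ`. -/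
theorem exists_gluing {μ ν : Measure (X × X)} [IsProbabilityMeasure μ] [IsProbabilityMeasure ν]
    (h : μ.map Prod.snd = ν.map Prod.fst) :
    ∃ π : Measure ((X × X) × X), IsProbabilityMeasure π ∧ π.map Prod.fst = μ ∧
      π.map (fun t => (t.1.2, t.2)) = ν := by
  have : Nonempty X := (nonempty_of_isProbabilityMeasure μ).map Prod.fst
  let κ : Kernel (X × X) X := ν.condKernel.comap Prod.snd measurable_snd
  refine ⟨μ ⊗ₘ κ, inferInstance, Measure.fst_compProd μ κ, ?_⟩
  conv_rhs => rw [← ν.disintegrate ν.condKernel, Measure.fst, ← h]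
  refine Measure.ext_of_lintegral _ fun f hf => ?_
  rw [lintegral_map hf (by fun_prop), Measure.lintegral_compProd (by fun_prop),
    Measure.lintegral_compProd hf, lintegral_map ?_ measurable_snd]
  · rfl
  · exact hf.lintegral_kernel_prod_right'

theorem edist_triangle_of_compact {p : ℝ≥0∞} (hp : 1 ≤ p) (α β γ : WSpace p X) :
    edist α γ ≤ edist α β + edist β γ := by
  have hp0 : p ≠ 0 := (zero_lt_one.trans_le hp).ne'
  rw [edist_eq_iInf_eLpNorm hp0 α β, edist_eq_iInf_eLpNorm hp0 β γ]
  simp only [ENNReal.iInf_add, ENNReal.add_iInf]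
  refine le_iInf₂ fun ν hν => le_iInf₂ fun μ hμ => ?_
  have : IsProbabilityMeasure μ := isProbabilityMeasure_of_map_fst hμ.1
  have : IsProbabilityMeasure ν := isProbabilityMeasure_of_map_fst hν.1
  obtain ⟨π, -, hπμ, hπν⟩ := exists_gluing (hμ.2.trans hν.1.symm)
  calc edist α γ
      ≤ eLpNorm (fun t : (X × X) × X => edist t.1.1 t.2) p π := by
        refine edist_map_le hp0 (by fun_prop) (by fun_prop) ?_ ?_
        · rw [← hμ.1, ← hπμ, Measure.map_map measurable_fst measurable_fst]
          rfl
        · rw [← hν.2, ← hπν, Measure.map_map measurable_snd (by fun_prop)]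
          rfl
    _ ≤ eLpNorm ((fun t : (X × X) × X => edist t.1.1 t.1.2) + fun t => edist t.1.2 t.2) p π :=
        eLpNorm_mono_enorm fun t => edist_triangle t.1.1 t.1.2 t.2
    _ ≤ eLpNorm (fun t : (X × X) × X => edist t.1.1 t.1.2) p π +
          eLpNorm (fun t : (X × X) × X => edist t.1.2 t.2) p π :=
        eLpNorm_add_le (by fun_prop) (by fun_prop) hp
    _ = eLpNorm (fun z : X × X => edist z.1 z.2) p μ +
          eLpNorm (fun z : X × X => edist z.1 z.2) p ν := by
        rw [← hπμ, ← hπν, eLpNorm_map_measure (by fun_prop) (by fun_prop),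
          eLpNorm_map_measure (by fun_prop) (by fun_prop)]
        rfl

theorem edist_comm_le {p : ℝ≥0∞} (hp : p ≠ 0) (α β : WSpace p X) : edist α β ≤ edist β α := by
  rw [edist_eq_iInf_eLpNorm hp β α]
  refine le_iInf₂ fun μ hμ => ?_
  simpa only [edist_comm] using edist_map_le hp measurable_snd measurable_fst hμ.2 hμ.1

theorem edist_self_eq_zero {p : ℝ≥0∞} (hp : p ≠ 0) (α : WSpace p X) : edist α α = 0 := by
  refine le_antisymm ?_ zero_le
  refine (edist_map_le hp measurable_id measurable_id Measure.map_id Measure.map_id).trans ?_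
  simp

theorem edist_lt_top_of_compact {p : ℝ≥0∞} (hp : p ≠ 0) (α β : WSpace p X) : edist α β < ∞ := by
  refine (edist_le_eLpNorm hp (μ := (α.1 : Measure X).prod (β.1 : Measure X)) ?_ ?_).trans_lt ?_
  · simp [Measure.map_fst_prod]
  · simp [Measure.map_snd_prod]
  · refine (eLpNorm_le_of_forall_ae_le (c := ediam (univ : Set X)) (.of_forall fun z =>
      edist_le_ediam_of_mem (mem_univ _) (mem_univ _))).trans_lt ?_
    exact (isCompact_univ (X := X)).isBounded.ediam_ne_top.lt_top

/-- Markov's inequality: pairs at distance at least `ε` have mass at most `ε * ε / ε`, and any other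
pair starting in `B` ends in its thickening. -/
theorem measure_le_measure_thickening_add {α β : Measure X} {μ : Measure (X × X)}
    (h₁ : μ.map Prod.fst = α) (h₂ : μ.map Prod.snd = β) {ε : ℝ≥0∞} (hε : ε ≠ 0) (hε' : ε ≠ ∞)
    (h : ∫⁻ z, edist z.1 z.2 ∂μ ≤ ε * ε) {B : Set X} (hB : MeasurableSet B) :
    α B ≤ β (thickening ε.toReal B) + ε := by
  rw [← h₁, ← h₂, Measure.map_apply measurable_fst hB,
    Measure.map_apply measurable_snd isOpen_thickening.measurableSet]
  calc μ (Prod.fst ⁻¹' B)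
      ≤ μ (Prod.snd ⁻¹' thickening ε.toReal B ∪ {z | ε ≤ edist z.1 z.2}) := by
        refine measure_mono fun z hz => ?_
        by_cases hzε : ε ≤ edist z.1 z.2
        · exact Or.inr hzε
        · refine Or.inl ((mem_thickening_iff_exists_edist_lt _ _).2 ⟨z.1, hz, ?_⟩)
          rw [ENNReal.ofReal_toReal hε', edist_comm]
          exact not_le.1 hzε
    _ ≤ μ (Prod.snd ⁻¹' thickening ε.toReal B) + μ {z | ε ≤ edist z.1 z.2} :=
        measure_union_le _ _
    _ ≤ _ := by
        gcongr
        refine (meas_ge_le_lintegral_div (by fun_prop) hε hε').trans ?_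
        exact ENNReal.div_le_of_le_mul h

/-- The `L^p` cost dominates the `L^1` cost, which controls the Lévy–Prokhorov distance, and that
distance separates measures. -/
theorem eq_of_edist_eq_zero_of_compact {p : ℝ≥0∞} (hp : 1 ≤ p) {α β : WSpace p X}
    (h : edist α β = 0) : α = β := by
  refine Subtype.ext (LevyProkhorov.toMeasureEquiv.symm.injective (edist_eq_zero.1 ?_))
  refine le_antisymm (levyProkhorovEDist_le_of_forall _ _ 0 fun ε B hε hε' hB => ?_) zero_le
  obtain ⟨μ, hμ, h₁, h₂, hlt⟩ := exists_eLpNorm_lt (zero_lt_one.trans_le hp).ne'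
    (h.trans_lt (ENNReal.mul_pos hε.ne' hε.ne'))
  have hle : ∫⁻ z, edist z.1 z.2 ∂μ ≤ ε * ε := by
    have := eLpNorm_le_eLpNorm_of_exponent_le (μ := μ)
      (f := fun z : X × X => edist z.1 z.2) hp (by fun_prop)
    rw [eLpNorm_one_eq_lintegral_enorm] at this
    exact this.trans hlt.le
  have hswap : Measurable (Prod.swap : X × X → X × X) := measurable_swap
  refine ⟨measure_le_measure_thickening_add h₁ h₂ hε.ne' hε'.ne hle hB,
    measure_le_measure_thickening_add (μ := μ.map Prod.swap) ?_ ?_ hε.ne' hε'.ne ?_ hB⟩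
  · rwa [Measure.map_map measurable_fst hswap]
  · rwa [Measure.map_map measurable_snd hswap]
  · rw [lintegral_map (by fun_prop) hswap]
    simpa only [Prod.fst_swap, Prod.snd_swap, edist_comm] using hle

/-- The Wasserstein distance makes `𝒲_p(X)` a metric space for compact `X`. -/
@[reducible] noncomputable def metricSpaceOfCompact {p : ℝ≥0∞} (hp : 1 ≤ p) :
    MetricSpace (WSpace p X) :=
  letI : EMetricSpace (WSpace p X) :=
    { edist_self := edist_self_eq_zero (zero_lt_one.trans_le hp).ne'
      edist_comm := fun α β => le_antisymm (edist_comm_le (zero_lt_one.trans_le hp).ne' α β)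
        (edist_comm_le (zero_lt_one.trans_le hp).ne' β α)
      edist_triangle := edist_triangle_of_compact hp
      eq_of_edist_eq_zero := eq_of_edist_eq_zero_of_compact hp }
  EMetricSpace.toMetricSpace fun α β =>
    (edist_lt_top_of_compact (zero_lt_one.trans_le hp).ne' α β).ne

end Compact

/-! ### Couplings under closed embeddings -/

section Embedding

variable {T S : Type*} [TopologicalSpace T] [MeasurableSpace T] [BorelSpace T]
  [TopologicalSpace S] [MeasurableSpace S] [BorelSpace S]

theorem support_map_of_isClosedEmbedding {F : T → S} (hF : IsClosedEmbedding F) (μ : Measure T) :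
    (μ.map F).support = F '' μ.support := by
  have hFm := hF.measurableEmbedding
  refine subset_antisymm (fun s hs => ?_) ?_
  · have hs' : s ∈ range F := by
      refine Measure.support_subset_of_isClosed hF.isClosed_range ?_ hs
      rw [mem_ae_iff, hFm.map_apply]
      simp
    obtain ⟨t, rfl⟩ := hs'
    refine ⟨t, (Measure.mem_support_iff_forall t).2 fun U hU => ?_, rfl⟩
    rw [hF.isInducing.nhds_eq_comap] at hU
    obtain ⟨V, hV, hVU⟩ := hU
    have := (Measure.mem_support_iff_forall _).1 hs V hV
    rw [hFm.map_apply] at this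
    exact this.trans_le (measure_mono hVU)
  · rintro _ ⟨t, ht, rfl⟩
    refine (Measure.mem_support_iff_forall _).2 fun V hV => ?_
    rw [hFm.map_apply]
    exact (Measure.mem_support_iff_forall t).1 ht _ (hF.continuous.continuousAt hV)

theorem cost_map_of_isClosedEmbedding {F : T → S} (hF : IsClosedEmbedding F) (μ : Measure T)
    (p : ℝ≥0∞) (c : S → ℝ≥0∞) :
    (if p = ∞ then ⨆ s ∈ (μ.map F).support, c s
      else (∫⁻ s, c s ^ p.toReal ∂μ.map F) ^ (1 / p.toReal)) =
    if p = ∞ then ⨆ t ∈ μ.support, c (F t)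
      else (∫⁻ t, c (F t) ^ p.toReal ∂μ) ^ (1 / p.toReal) := by
  rw [support_map_of_isClosedEmbedding hF, iSup_image, hF.measurableEmbedding.lintegral_map]

/-- Both marginals live on `range φ`, so `ν` lives on `range F` and `ν.comap F` works. Abstract `T`
and `S` stand for `X × X` and `Z × Z` with their Borel σ-algebras. -/
theorem exists_map_eq_of_marginals {X Z : Type*} [MeasurableSpace X] [MeasurableSpace Z]
    {φ : X → Z} (hφ : MeasurableEmbedding φ) {F : T → S} (hF : IsClosedEmbedding F)
    {p₁ p₂ : T → X} {q₁ q₂ : S → Z} (hp₁ : Measurable p₁) (hp₂ : Measurable p₂)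
    (hq₁ : Measurable q₁) (hq₂ : Measurable q₂)
    (h₁ : ∀ t, q₁ (F t) = φ (p₁ t)) (h₂ : ∀ t, q₂ (F t) = φ (p₂ t))
    (hr : ∀ s, q₁ s ∈ range φ → q₂ s ∈ range φ → s ∈ range F)
    {α β : Measure X} {ν : Measure S} (hα : ν.map q₁ = α.map φ) (hβ : ν.map q₂ = β.map φ) :
    ∃ μ : Measure T, μ.map F = ν ∧ μ.map p₁ = α ∧ μ.map p₂ = β := by
  have key : ∀ (q : S → Z) (γ : Measure X), Measurable q → ν.map q = γ.map φ →
      ∀ᵐ s ∂ν, q s ∈ range φ := by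
    intro q γ hq h
    refine ae_of_ae_map hq.aemeasurable (p := fun z => z ∈ range φ) ?_
    rw [h, ae_iff, hφ.map_apply]
    have hempty : φ ⁻¹' {z | z ∉ range φ} = ∅ := by ext; simp
    exact (congrArg γ hempty).trans measure_empty
  have hmap : (ν.comap F).map F = ν := by
    rw [hF.measurableEmbedding.map_comap]
    refine Measure.restrict_eq_self_of_ae_mem ?_
    filter_upwards [key q₁ α hq₁ hα, key q₂ β hq₂ hβ] with s hs₁ hs₂ using hr s hs₁ hs₂
  have marg : ∀ (q : S → Z) (r : T → X) (γ : Measure X), Measurable q → Measurable r →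
      (∀ t, q (F t) = φ (r t)) → ν.map q = γ.map φ → (ν.comap F).map r = γ := by
    intro q r γ hq hr h hγ
    rw [← hφ.comap_map γ, ← hγ, ← hmap,
      Measure.map_map hq hF.measurableEmbedding.measurable, hmap, (funext h : q ∘ F = φ ∘ r),
      ← Measure.map_map hφ.measurable hr, hφ.comap_map]
  exact ⟨ν.comap F, hmap, marg q₁ p₁ α hq₁ hp₁ h₁ hα, marg q₂ p₂ β hq₂ hp₂ h₂ hβ⟩

end Embedding

theorem isIsometricEmbedding_pushforward {X : Type u} {Z : Type v}
    [MetricSpace X] [CompactSpace X] [MeasurableSpace X] [BorelSpace X]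
    [MetricSpace Z] [MeasurableSpace Z] [BorelSpace Z] (p : ℝ≥0∞)
    {φ : X → Z} (hφ : Isometry φ) : IsIsometricEmbedding (pushforward p hφ) := by
  intro α β
  have hφe : MeasurableEmbedding φ := hφ.isClosedEmbedding.measurableEmbedding
  -- `Z` need not be separable, so the Borel σ-algebra of `Z × Z` may be finer than the product one;
  -- it is passed explicitly below.
  let mX : MeasurableSpace (X × X) := borel _
  let mZ : MeasurableSpace (Z × Z) := borel _
  have bX : @BorelSpace (X × X) _ mX := @BorelSpace.mk _ _ mX rfl
  have bZ : @BorelSpace (Z × Z) _ mZ := @BorelSpace.mk _ _ mZ rfl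
  have oX := @BorelSpace.opensMeasurable _ _ mX bX
  have oZ := @BorelSpace.opensMeasurable _ _ mZ bZ
  have hF : IsClosedEmbedding (Prod.map φ φ) := hφ.isClosedEmbedding.prodMap hφ.isClosedEmbedding
  have hFm : @Measurable _ _ mX mZ (Prod.map φ φ) := hF.continuous.borel_measurable
  have f₁ : @Measurable _ _ mX _ (Prod.fst : X × X → X) :=
    @Continuous.measurable _ _ _ mX oX _ _ _ _ continuous_fst
  have f₂ : @Measurable _ _ mX _ (Prod.snd : X × X → X) :=
    @Continuous.measurable _ _ _ mX oX _ _ _ _ continuous_snd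
  have g₁ : @Measurable _ _ mZ _ (Prod.fst : Z × Z → Z) :=
    @Continuous.measurable _ _ _ mZ oZ _ _ _ _ continuous_fst
  have g₂ : @Measurable _ _ mZ _ (Prod.snd : Z × Z → Z) :=
    @Continuous.measurable _ _ _ mZ oZ _ _ _ _ continuous_snd
  have hcost : ∀ μ : BorelMeasureProd X,
      cost p (@Measure.map _ _ mX mZ (Prod.map φ φ) μ) = cost p μ := by
    intro μ
    refine (@cost_map_of_isClosedEmbedding _ _ _ mX bX _ mZ bZ _ hF μ p
      (fun z => edist z.1 z.2)).trans ?_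
    simp only [Prod.map_fst, Prod.map_snd, hφ.edist_eq]
    rfl
  refine le_antisymm (le_iInf₂ fun μ hμ => ?_) (le_iInf₂ fun ν hν => ?_)
  · refine (iInf₂_le (@Measure.map _ _ mX mZ (Prod.map φ φ) μ) ⟨?_, ?_⟩).trans_eq (hcost μ)
    · refine (@Measure.map_map _ _ _ mX mZ _ _ _ _ g₁ hFm).trans ?_
      refine (@Measure.map_map _ _ _ mX _ _ μ _ _ hφe.measurable f₁).symm.trans ?_
      exact congrArg _ hμ.1
    · refine (@Measure.map_map _ _ _ mX mZ _ _ _ _ g₂ hFm).trans ?_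
      refine (@Measure.map_map _ _ _ mX _ _ μ _ _ hφe.measurable f₂).symm.trans ?_
      exact congrArg _ hμ.2
  · obtain ⟨μ, hμ, h₁, h₂⟩ := @exists_map_eq_of_marginals _ _ _ mX bX _ mZ bZ _ _ _ _ _ hφe _ hF
      _ _ _ _ f₁ f₂ g₁ g₂ (fun _ => rfl) (fun _ => rfl)
      (by rintro ⟨_, _⟩ ⟨a, rfl⟩ ⟨b, rfl⟩; exact ⟨(a, b), rfl⟩) _ _ _ hν.1 hν.2
    refine (iInf₂_le μ ⟨h₁, h₂⟩).trans_eq ?_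
    rw [← hμ]
    exact (hcost μ).symm

/-! ### Hausdorff distance inside a compact space -/

theorem hausdorff_image {A : Type u} {B : Type v} [EDist A] [EDist B] {f : A → B}
    (hf : IsIsometricEmbedding f) (S T : Set A) : hausdorff (f '' S) (f '' T) = hausdorff S T := by
  simp only [hausdorff, iSup_image, iInf_image, hf _ _]

/-- Take the first point of a dense sequence that is close enough; the strict bound makes the
conditions open, so the index is measurable in `x`. -/
theorem exists_measurable_edist_lt {X Y Z : Type*} [TopologicalSpace X] [MeasurableSpace X]
    [OpensMeasurableSpace X] [TopologicalSpace Y] [TopologicalSpace.SeparableSpace Y]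
    [MeasurableSpace Y] [PseudoEMetricSpace Z] {φ : X → Z} {ψ : Y → Z} (hφ : Continuous φ)
    (hψ : Continuous ψ) {r : ℝ≥0∞} (hr : ∀ x, ∃ y, edist (φ x) (ψ y) < r) :
    ∃ f : X → Y, Measurable f ∧ ∀ x, edist (φ x) (ψ (f x)) < r := by
  classical
  rcases isEmpty_or_nonempty X with hX | ⟨⟨x₀⟩⟩
  · exact ⟨isEmptyElim, measurable_of_empty _, isEmptyElim⟩
  have : Nonempty Y := ⟨(hr x₀).choose⟩
  let d := TopologicalSpace.denseSeq Y
  have hd : ∀ x, ∃ n, edist (φ x) (ψ (d n)) < r := fun x =>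
    (TopologicalSpace.denseRange_denseSeq Y).exists_mem_open
      (s := {y | edist (φ x) (ψ y) < r}) (isOpen_lt (by fun_prop) continuous_const) (hr x)
  refine ⟨fun x => d (Nat.find (hd x)), ?_, fun x => Nat.find_spec (hd x)⟩
  refine measurable_from_nat.comp (measurable_find hd fun n => ?_)
  exact (isOpen_lt (by fun_prop) continuous_const).measurableSet

theorem hasFiniteMoment_of_compact {X : Type u} [MetricSpace X] [CompactSpace X]
    [MeasurableSpace X] [BorelSpace X] (p : ℝ≥0∞) (α : ProbabilityMeasure X) :
    HasFiniteMoment p α := by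
  have h := hasFiniteMoment_map p isometry_id α
  have hα : α.map (isometry_id (α := X)).continuous.aemeasurable = α :=
    Subtype.ext Measure.map_id
  rwa [hα] at h

section Excess

variable {X : Type u} {Y : Type v} {K : Type w}
  [MetricSpace X] [CompactSpace X] [MeasurableSpace X] [BorelSpace X]
  [MetricSpace Y] [CompactSpace Y] [MeasurableSpace Y] [BorelSpace Y]
  [MetricSpace K] [CompactSpace K] [MeasurableSpace K] [BorelSpace K]

theorem exists_edist_pushforward_le {p c : ℝ≥0∞} (hp : p ≠ 0) {φ : X → K} {ψ : Y → K}
    (hφ : Isometry φ) (hψ : Isometry ψ) (hc : ∀ x, ∃ y, edist (φ x) (ψ y) < c) (α : WSpace p X) :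
    ∃ β : WSpace p Y, edist (pushforward p hφ α) (pushforward p hψ β) ≤ c := by
  obtain ⟨f, hf, hfc⟩ := exists_measurable_edist_lt hφ.continuous hψ.continuous hc
  refine ⟨⟨α.1.map hf.aemeasurable, hasFiniteMoment_of_compact p _⟩, ?_⟩
  have : IsProbabilityMeasure (α.1 : Measure X) := α.1.2
  refine (edist_map_le hp (π := (α.1 : Measure X)) hφ.continuous.measurable
    (hψ.continuous.measurable.comp hf) rfl ?_).trans
    (eLpNorm_le_of_forall_ae_le (.of_forall fun x => (hfc x).le))
  exact (Measure.map_map hψ.continuous.measurable hf).symm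

/-- Any coupling here is concentrated on `{φ x} × range ψ`, where the distance is at least the
left-hand side. -/
theorem iInf_edist_le_edist_pushforward_dirac {p : ℝ≥0∞} (hp : p ≠ 0) {φ : X → K} {ψ : Y → K}
    (hφ : Isometry φ) (hψ : Isometry ψ) (x : X) (β : WSpace p Y) :
    ⨅ y, edist (φ x) (ψ y) ≤ edist
      (pushforward p hφ ⟨⟨Measure.dirac x, inferInstance⟩, hasFiniteMoment_of_compact p _⟩)
      (pushforward p hψ β) := by
  rw [edist_eq_iInf_eLpNorm hp]
  refine le_iInf₂ fun μ hμ => ?_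
  have : IsProbabilityMeasure μ := isProbabilityMeasure_of_map_fst hμ.1
  have h₁ : μ.map Prod.fst = Measure.dirac (φ x) :=
    hμ.1.trans (Measure.map_dirac' hφ.continuous.measurable x)
  have h₂ : μ.map Prod.snd = (β.1 : Measure Y).map ψ := hμ.2
  have h₁' : ∀ᵐ z ∂μ, z.1 = φ x := by
    refine ae_of_ae_map measurable_fst.aemeasurable (p := fun z => z = φ x) ?_
    rw [h₁, ae_dirac_eq]
    exact Filter.eventually_pure.2 rfl
  have h₂' : ∀ᵐ z ∂μ, z.2 ∈ range ψ := by
    refine ae_of_ae_map measurable_snd.aemeasurable (p := fun z => z ∈ range ψ) ?_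
    rw [h₂]
    exact (ae_map_iff (p := fun z => z ∈ range ψ) hψ.continuous.aemeasurable
      hψ.isClosedEmbedding.isClosed_range.measurableSet).2 (.of_forall mem_range_self)
  refine le_eLpNorm_of_forall_ae_le hp ?_
  filter_upwards [h₁', h₂'] with z hz₁ hz₂
  obtain ⟨y, hy⟩ := hz₂
  rw [hz₁, ← hy]
  exact iInf_le _ y

theorem iSup_iInf_edist_pushforward {p : ℝ≥0∞} (hp : p ≠ 0) {φ : X → K} {ψ : Y → K}
    (hφ : Isometry φ) (hψ : Isometry ψ) :
    ⨆ α : WSpace p X, ⨅ β : WSpace p Y, edist (pushforward p hφ α) (pushforward p hψ β) =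
      ⨆ x, ⨅ y, edist (φ x) (ψ y) := by
  refine le_antisymm ?_ (iSup_le fun x => ?_)
  -- The measurable selection needs strict room, hence `c` strictly above the supremum.
  · refine le_of_forall_gt_imp_ge_of_dense fun c hc => iSup_le fun α => ?_
    obtain ⟨β, hβ⟩ := exists_edist_pushforward_le hp hφ hψ
      (fun x => iInf_lt_iff.1 ((le_iSup (fun x => ⨅ y, edist (φ x) (ψ y)) x).trans_lt hc)) α
    exact iInf_le_of_le β hβ
  · exact le_iSup_of_le _ (le_iInf (iInf_edist_le_edist_pushforward_dirac hp hφ hψ x))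

theorem hausdorff_range_pushforward_of_compact {p : ℝ≥0∞} (hp : p ≠ 0) {φ : X → K} {ψ : Y → K}
    (hφ : Isometry φ) (hψ : Isometry ψ) :
    hausdorff (range (pushforward p hφ)) (range (pushforward p hψ)) =
      hausdorff (range φ) (range ψ) := by
  simp only [hausdorff, iSup_range, iInf_range, iSup_iInf_edist_pushforward hp]

end Excess

/-! ### Reduction to a compact ambient space -/

theorem exists_compact_isometric_factorization {X : Type u} {Y : Type v} {Z : Type w}
    [MetricSpace X] [CompactSpace X] [MetricSpace Y] [CompactSpace Y] [MetricSpace Z]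
    {φ : X → Z} {ψ : Y → Z} (hφ : Isometry φ) (hψ : Isometry ψ) :
    ∃ (K : Type w) (_ : MetricSpace K) (_ : CompactSpace K) (ι : K → Z) (φ' : X → K) (ψ' : Y → K),
      Isometry ι ∧ Isometry φ' ∧ Isometry ψ' ∧ ι ∘ φ' = φ ∧ ι ∘ ψ' = ψ := by
  have hK : IsCompact (range φ ∪ range ψ) :=
    (isCompact_range hφ.continuous).union (isCompact_range hψ.continuous)
  exact ⟨↥(range φ ∪ range ψ), inferInstance, isCompact_iff_compactSpace.1 hK, Subtype.val,
    fun x => ⟨φ x, Or.inl ⟨x, rfl⟩⟩, fun y => ⟨ψ y, Or.inr ⟨y, rfl⟩⟩, isometry_subtype_coe,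
    fun a b => hφ a b, fun a b => hψ a b, rfl, rfl⟩

section Union

variable {X : Type u} {Y : Type v} {Z : Type w}
  [MetricSpace X] [CompactSpace X] [MeasurableSpace X] [BorelSpace X]
  [MetricSpace Y] [CompactSpace Y] [MeasurableSpace Y] [BorelSpace Y] [MetricSpace Z]

theorem pushforward_comp {K : Type*} [MetricSpace K] [CompactSpace K] [MeasurableSpace K]
    [BorelSpace K] [MeasurableSpace Z] [BorelSpace Z] (p : ℝ≥0∞) {ι : K → Z} {φ : X → K}
    (hι : Isometry ι) (hφ : Isometry φ) (α : WSpace p X) :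
    pushforward p (hι.comp hφ) α = pushforward p hι (pushforward p hφ α) :=
  Subtype.ext <| Subtype.ext
    (Measure.map_map hι.continuous.measurable hφ.continuous.measurable).symm

theorem hausdorff_range_pushforward [MeasurableSpace Z] [BorelSpace Z] {p : ℝ≥0∞} (hp : p ≠ 0)
    {φ : X → Z} {ψ : Y → Z} (hφ : Isometry φ) (hψ : Isometry ψ) :
    hausdorff (range (pushforward p hφ)) (range (pushforward p hψ)) =
      hausdorff (range φ) (range ψ) := by
  obtain ⟨K, _, _, ι, φ', ψ', hι, hφ', hψ', rfl, rfl⟩ :=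
    exists_compact_isometric_factorization hφ hψ
  borelize K
  have h₁ : pushforward p hφ = pushforward p hι ∘ pushforward p hφ' :=
    funext (pushforward_comp p hι hφ')
  have h₂ : pushforward p hψ = pushforward p hι ∘ pushforward p hψ' :=
    funext (pushforward_comp p hι hψ')
  rw [h₁, h₂, range_comp, range_comp, range_comp, range_comp,
    hausdorff_image (isIsometricEmbedding_pushforward p hι), hausdorff_image hι,
    hausdorff_range_pushforward_of_compact hp]

end Union

/-! ### The Gromov–Hausdorff bound -/

theorem ghEDist_le {A : Type u} {B : Type v} [EDist A] [EDist B] {Z : Type (max u v)}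
    [MetricSpace Z] {φ : A → Z} {ψ : B → Z} (hφ : IsIsometricEmbedding φ)
    (hψ : IsIsometricEmbedding ψ) : ghEDist A B ≤ hausdorffEDist (range φ) (range ψ) :=
  (iInf₂_le Z ‹_›).trans <| (iInf₂_le φ ψ).trans <| iInf₂_le hφ hψ

theorem ghEDist_wSpace_le {X : Type u} {Y : Type v}
    [MetricSpace X] [CompactSpace X] [MeasurableSpace X] [BorelSpace X]
    [MetricSpace Y] [CompactSpace Y] [MeasurableSpace Y] [BorelSpace Y]
    {p : ℝ≥0∞} (hp : 1 ≤ p) : ghEDist (WSpace p X) (WSpace p Y) ≤ ghEDist X Y := by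
  refine le_iInf₂ fun Z _ => le_iInf₂ fun φ ψ => le_iInf₂ fun hφ hψ => ?_
  obtain ⟨K, _, _, ι, φ', ψ', hι, hφ', hψ', rfl, rfl⟩ :=
    exists_compact_isometric_factorization (φ := φ) (ψ := ψ) hφ hψ
  borelize K
  -- Passing to `K` is essential: `WSpace p K` is now a metric space, in the universe required of
  -- competitors.
  let _ := metricSpaceOfCompact (X := K) hp
  refine (ghEDist_le (isIsometricEmbedding_pushforward p hφ')
    (isIsometricEmbedding_pushforward p hψ')).trans_eq ?_
  rw [← hausdorff_eq, ← hausdorff_eq, range_comp, range_comp, hausdorff_image hι]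
  exact hausdorff_range_pushforward_of_compact (zero_lt_one.trans_le hp).ne' hφ' hψ'

end WassersteinHyperspace

theorem mainTheorem8 {X : Type u} {Y : Type v}
    [MetricSpace X] [CompactSpace X] [MeasurableSpace X] [BorelSpace X]
    [MetricSpace Y] [CompactSpace Y] [MeasurableSpace Y] [BorelSpace Y]
    (p : ℝ≥0∞) (hp : 1 ≤ p) :
    (∀ (Z : Type w) [MetricSpace Z] [MeasurableSpace Z] [BorelSpace Z]
      (φX : X → Z) (φY : Y → Z) (hX : Isometry φX) (hY : Isometry φY),
      WassersteinHyperspace.IsIsometricEmbedding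
        (WassersteinHyperspace.pushforward p hX) ∧
      WassersteinHyperspace.IsIsometricEmbedding
        (WassersteinHyperspace.pushforward p hY) ∧
      WassersteinHyperspace.hausdorff
        (Set.range (WassersteinHyperspace.pushforward p hX))
        (Set.range (WassersteinHyperspace.pushforward p hY)) =
      Metric.hausdorffEDist (Set.range φX) (Set.range φY)) ∧
    WassersteinHyperspace.ghEDist
      (WassersteinHyperspace.WSpace p X) (WassersteinHyperspace.WSpace p Y) ≤
    WassersteinHyperspace.ghEDist X Y := by
  refine ⟨fun Z _ _ _ φX φY hX hY => ⟨?_, ?_, ?_⟩, WassersteinHyperspace.ghEDist_wSpace_le hp⟩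
  · exact WassersteinHyperspace.isIsometricEmbedding_pushforward p hX
  · exact WassersteinHyperspace.isIsometricEmbedding_pushforward p hY
  · rw [← WassersteinHyperspace.hausdorff_eq]
    exact WassersteinHyperspace.hausdorff_range_pushforward (zero_lt_one.trans_le hp).ne' hX hY
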